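/- **Theorem (shifted $M/M/\infty$ representation of the fluid MGF).** Let $c\ge 1$ be an integer, $\mu,\theta>0$, and let $\lambda:[0,\infty)\to\mathbb R$ be locally integrable with $\inf_{t\ge0}\lambda(t)>c\mu$. Let $q(0)>c$ and $\gamma=\frac{c(\theta-\mu)}{\theta}$. For an interval $I\ni 0$, a *fluid MGF on $I$* of the Erlang-A queue (arrival rate $\lambda(t)$, $c$ servers, service rate $\mu$, abandonment rate $\theta$, initial value $q(0)$) is a function $M_f(t,\alpha)$, $t\ge0$, $\alpha\in I$, which is continuous with continuous derivative in $\alpha$ and solves $$\frac{\partial M_f}{\partial t}=\lambda(t)(e^\alpha-1)M_f+\theta(e^{-\alpha}-1)\frac{\partial M_f}{\partial\alpha}-(\theta-\mu)(e^{-\alpha}-1)\Big(\frac{\partial M_f}{\partial\alpha}\wedge c\,M_f\Big),\qquad M_f(0,\alpha)=e^{\alpha q(0)} .$$ The *MGF $N(t,\alpha)$ of the $M/M/\infty$ queue* with arrival rate $\lambda(t)$, service rate $\theta$ and real initial value $x_0$ is the solution, in the same sense with $I=\mathbb R$, of $$\frac{\partial N}{\partial t}=\lambda(t)(e^\alpha-1)N+\theta(e^{-\alpha}-1)\frac{\partial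 N}{\partial\alpha},\qquad N(0,\alpha)=e^{\alpha x_0}.$$ Both equations are understood integrated in $t$ (for continuous $\lambda$ this is the classical sense). Take $x_0=q(0)-\gamma$. Then: 1. $N$ exists and is unique. If $x_0=n_0$ is a non-negative integer, then $N(t,\alpha)=\mathbb E[e^{\alpha Q_\infty(t)}]<\infty$ for all $t\ge0$, $\alpha\in\mathbb R$, whenever the laws of $Q_\infty(t)$, $t\ge 0$, on $\{0,1,2,\dots\}$ have time-continuous point probabilities, start at $Q_\infty(0)=n_0$ and satisfy the (integrated) Kolmogorov forward equations with birth rate $\lambda(t)$ and death rate $\theta n$ in state $n$. 2. There is $\delta>0$ such that $e^{\alpha\gamma}N(t,\alpha)$ is a fluid MGF on $(-\delta,\infty)$, and every fluid MGF $M_f$ on any interval $I\ni0$ satisfies $$M_f(t,\alpha)=e^{\alpha\gamma}N(t,\alpha)\qquad\text{for all } t\ge0,\ \alpha\in I,\ \alpha>-\delta .$$ That is, in a neighbourhood of $0$ and for all $\alpha\ge 0$, the fluid MGF is the MGF of the $M/M/\infty$ queue with arrival rate $\lambda(t)$, service rate $\theta$ and initial value $q(0)-\gamma$, shifted by $\gamma$.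 3. If a fluid MGF on some interval $I\ni 0$ of positive length is there the MGF of real random variables $Q_f(t)$, $t\ge 0$, with $\mathbb E[e^{\alpha Q_f(t)}]<\infty$ for all $\alpha\in\mathbb R$, then $\mathbb E[e^{\alpha Q_f(t)}]=e^{\alpha\gamma}N(t,\alpha)$ for all $t\ge0$ and all $\alpha\in\mathbb R$; and if moreover $q(0)-\gamma=n_0$ is an integer, then $Q_f(t)$ has the law of $Q_\infty(t)+\gamma$, with $Q_\infty$ as in 1. -/

import Mathlib

open MeasureTheory ProbabilityTheory Set

/-- `IsFluidMGF lam c μ θ q₀ I M`: on `t ≥ 0`, `α ∈ I`, the function `M t α` is a fluid approximation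
of the moment generating function of the Erlang-A queue with arrival rate `lam`, `c` servers,
service rate `μ`, abandonment rate `θ` and initial value `q₀`, i.e. a solution of
`∂M/∂t = lam(t) (e^α - 1) M + θ (e^{-α} - 1) ∂M/∂α - (θ - μ) (e^{-α} - 1) min (∂M/∂α) (c M)`,
`M 0 α = e^{α q₀}`.
`M` and `D = ∂M/∂α` are jointly continuous and the equation is integrated in time, so that the
arrival rate only has to be locally integrable; where `lam` is continuous this is the equation with
the classical time derivative. -/
def IsFluidMGF (lam : ℝ → ℝ) (c μ θ q₀ : ℝ) (I : Set ℝ) (M : ℝ → ℝ → ℝ) : Prop :=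
  ∃ D : ℝ → ℝ → ℝ,
    ContinuousOn (Function.uncurry M) (Ici 0 ×ˢ I) ∧
    ContinuousOn (Function.uncurry D) (Ici 0 ×ˢ I) ∧
    (∀ t, 0 ≤ t → ∀ α ∈ I, HasDerivWithinAt (M t) (D t α) I α) ∧
    (∀ t, 0 ≤ t → ∀ α ∈ I,
      M t α = Real.exp (α * q₀) +
        ∫ s in (0 : ℝ)..t,
          (lam s * (Real.exp α - 1) * M s α + θ * (Real.exp (-α) - 1) * D s α
            - (θ - μ) * (Real.exp (-α) - 1) * min (D s α) (c * M s α)))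

/-- `IsMMInfMGF lam θ x₀ N`: `N t α` (`t ≥ 0`, `α ∈ ℝ`) is the moment generating function of the
`M/M/∞` queue with arrival rate `lam`, service rate `θ` and (real) initial value `x₀`, i.e. the
solution of the forward equation
`∂N/∂t = lam(t) (e^α - 1) N + θ (e^{-α} - 1) ∂N/∂α`, `N 0 α = e^{α x₀}`. -/
def IsMMInfMGF (lam : ℝ → ℝ) (θ x₀ : ℝ) (N : ℝ → ℝ → ℝ) : Prop :=
  ∃ D : ℝ → ℝ → ℝ,
    ContinuousOn (Function.uncurry N) (Ici 0 ×ˢ univ) ∧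
    ContinuousOn (Function.uncurry D) (Ici 0 ×ˢ univ) ∧
    (∀ t, 0 ≤ t → ∀ α, HasDerivAt (N t) (D t α) α) ∧
    (∀ t, 0 ≤ t → ∀ α,
      N t α = Real.exp (α * x₀) +
        ∫ s in (0 : ℝ)..t,
          (lam s * (Real.exp α - 1) * N s α + θ * (Real.exp (-α) - 1) * D s α))

/-- `IsMMInfLaw lam θ n₀ P`: `P t` (`t ≥ 0`) is the law at time `t` of the `M/M/∞` queue with arrival
rate `lam`, service rate `θ` per customer and `n₀` customers at time `0`: probability measures on
`ℕ` that start at `δ_{n₀}` and satisfy the Kolmogorov forward equations of the birth-death chain with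
birth rate `lam(t)` and death rate `θ n` in state `n`. -/
structure IsMMInfLaw (lam : ℝ → ℝ) (θ : ℝ) (n₀ : ℕ) (P : ℝ → Measure ℕ) : Prop where
  prob : ∀ t, 0 ≤ t → IsProbabilityMeasure (P t)
  init : P 0 = Measure.dirac n₀
  cont : ∀ n : ℕ, ContinuousOn (fun t => (P t).real {n}) (Ici 0)
  forward : ∀ t, 0 ≤ t → ∀ n : ℕ,
    (P t).real {n} = (P 0).real {n} +
      ∫ s in (0 : ℝ)..t,
        (lam s * ((if n = 0 then 0 else (P s).real {n - 1}) - (P s).real {n})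
          + θ * (((n : ℝ) + 1) * (P s).real {n + 1} - (n : ℝ) * (P s).real {n}))

/-! On the set where `∂M/∂α ≥ c M`, the minimum equals `c M` and the fluid equation becomes linear.
Since `θ γ = c (θ - μ)`, multiplying by `e^{αγ}` then turns the `M/M/∞` equation into it. The
explicit MGF `mmInfMGF` has logarithmic derivative at least `c - γ = cμ/θ` for `α > -δ`
(`exists_le_mmInfLogDeriv`), because both `lam/θ` and the initial value exceed this level. So the
shifted MGF stays in the linear regime (`isFluidMGF_exp_mul_mmInfMGF`).

Uniqueness rests on a maximum principle (`transport_maximum_principle`). The difference of two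
minima is a convex combination of the differences, so the difference of two solutions satisfies a
linear transport equation with speed a nonnegative multiple of `e^{-α} - 1`. At a positive maximum
this term has a favourable sign on every interval containing `0`, so no boundary data in `α` are
needed.

The law of the queue is tied to `mmInfMGF` by transporting its generating function along
characteristics (`hasSum_pow_of_lt_one`) and continuing it analytically. The identity theorem
likewise extends the equality of MGFs from a neighbourhood of `0` in `I` to all real `α`. -/

/-! ### Calculus of absolutely continuous functions, for a merely integrable arrival rate. -/

/-- `f` is absolutely continuous on `[0, T]` with almost everywhere derivative `f'`. -/
def HasACDerivOn (f f' : ℝ → ℝ) (T : ℝ) : Prop :=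
  AbsolutelyContinuousOnInterval f 0 T ∧ ∀ᵐ x, x ∈ uIcc 0 T → HasDerivAt f (f' x) x

theorem absolutelyContinuousOnInterval_congr {f g : ℝ → ℝ} {a b : ℝ}
    (hf : AbsolutelyContinuousOnInterval f a b) (h : EqOn g f (uIcc a b)) :
    AbsolutelyContinuousOnInterval g a b := by
  rw [absolutelyContinuousOnInterval_iff] at hf ⊢
  intro ε hε
  obtain ⟨δ, hδ, H⟩ := hf ε hε
  refine ⟨δ, hδ, fun E hE hlt => ?_⟩
  convert H E hE hlt using 1
  refine Finset.sum_congr rfl fun i hi => ?_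
  rw [h (hE.1 i hi).1, h (hE.1 i hi).2]

theorem LipschitzOnWith.comp_absolutelyContinuousOnInterval {f φ : ℝ → ℝ} {a b : ℝ} {s : Set ℝ}
    {K : NNReal} (hφ : LipschitzOnWith K φ s) (hf : AbsolutelyContinuousOnInterval f a b)
    (hs : MapsTo f (uIcc a b) s) : AbsolutelyContinuousOnInterval (fun x => φ (f x)) a b := by
  rw [absolutelyContinuousOnInterval_iff] at hf ⊢
  intro ε hε
  obtain ⟨δ, hδ, H⟩ := hf (ε / (K + 1)) (by positivity)
  refine ⟨δ, hδ, fun E hE hlt => ?_⟩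
  calc _ ≤ ∑ i ∈ Finset.range E.1, K * dist (f (E.2 i).1) (f (E.2 i).2) :=
        Finset.sum_le_sum fun i hi =>
          hφ.dist_le_mul _ (hs (hE.1 i hi).1) _ (hs (hE.1 i hi).2)
    _ = K * ∑ i ∈ Finset.range E.1, dist (f (E.2 i).1) (f (E.2 i).2) := by rw [Finset.mul_sum]
    _ ≤ K * (ε / (K + 1)) := by gcongr; exact (H E hE hlt).le
    _ < ε := by
      rw [mul_div_assoc', div_lt_iff₀ (by positivity)]
      nlinarith

namespace HasACDerivOn

variable {f f' g g' : ℝ → ℝ} {T : ℝ}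

theorem congr_deriv (hf : HasACDerivOn f f' T) (h : ∀ x ∈ uIcc 0 T, f' x = g' x) :
    HasACDerivOn f g' T :=
  ⟨hf.1, by filter_upwards [hf.2] with x hx hxT; rw [← h x hxT]; exact hx hxT⟩

theorem mul (hf : HasACDerivOn f f' T) (hg : HasACDerivOn g g' T) :
    HasACDerivOn (fun x => f x * g x) (fun x => f' x * g x + f x * g' x) T :=
  ⟨hf.1.fun_mul hg.1, by
    filter_upwards [hf.2, hg.2] with x h1 h2 hx using (h1 hx).mul (h2 hx)⟩

theorem add (hf : HasACDerivOn f f' T) (hg : HasACDerivOn g g' T) :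
    HasACDerivOn (fun x => f x + g x) (fun x => f' x + g' x) T :=
  ⟨hf.1.fun_add hg.1, by
    filter_upwards [hf.2, hg.2] with x h1 h2 hx using (h1 hx).add (h2 hx)⟩

theorem const_mul (hf : HasACDerivOn f f' T) (k : ℝ) :
    HasACDerivOn (fun x => k * f x) (fun x => k * f' x) T :=
  ⟨hf.1.const_mul k, by filter_upwards [hf.2] with x h1 hx using (h1 hx).const_mul k⟩

theorem exp (hf : HasACDerivOn f f' T) :
    HasACDerivOn (fun x => Real.exp (f x)) (fun x => Real.exp (f x) * f' x) T := by
  refine ⟨?_, by filter_upwards [hf.2] with x h1 hx using (h1 hx).exp⟩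
  obtain ⟨C, hC⟩ := hf.1.exists_bound
  obtain ⟨K, hK⟩ := (Real.contDiff_exp (n := 1)).contDiffOn.exists_lipschitzOnWith (by decide)
    (convex_Icc (-C) C) isCompact_Icc
  exact hK.comp_absolutelyContinuousOnInterval hf.1 fun x hx => abs_le.1 (hC x hx)

theorem of_contDiff (hf : ContDiff ℝ 1 f) (h : ∀ x, HasDerivAt f (f' x) x) :
    HasACDerivOn f f' T :=
  ⟨hf.contDiffOn.absolutelyContinuousOnInterval, Filter.Eventually.of_forall fun x _ => h x⟩

theorem intervalIntegrable (hf : HasACDerivOn f f' T) : IntervalIntegrable f' volume 0 T := by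
  refine hf.1.intervalIntegrable_deriv.congr_ae ?_
  rw [Filter.EventuallyEq, ae_restrict_iff' measurableSet_uIoc]
  filter_upwards [hf.2] with x hx hxT using (hx (uIoc_subset_uIcc hxT)).deriv

theorem integral_eq (hf : HasACDerivOn f f' T) : ∫ s in (0 : ℝ)..T, f' s = f T - f 0 := by
  rw [← hf.1.integral_deriv_eq_sub]
  refine intervalIntegral.integral_congr_ae ?_
  filter_upwards [hf.2] with x hx hxT using (hx (uIoc_subset_uIcc hxT)).deriv.symm

theorem of_integral (hT : 0 ≤ T) (hint : IntervalIntegrable f' volume 0 T)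
    (h : ∀ t ∈ Icc 0 T, f t = f 0 + ∫ s in (0 : ℝ)..t, f' s) : HasACDerivOn f f' T := by
  have hac := hint.absolutelyContinuousOnInterval_intervalIntegral (c := 0) left_mem_uIcc
  have hlip : LipschitzOnWith 1 (fun x : ℝ => f 0 + x) univ :=
    (LipschitzWith.of_dist_le_mul fun x y => by simp).lipschitzOnWith
  refine ⟨absolutelyContinuousOnInterval_congr
    (hlip.comp_absolutelyContinuousOnInterval hac (mapsTo_univ _ _))
    fun x hx => h x (by rwa [uIcc_of_le hT] at hx), ?_⟩
  -- The integral formula holds only on `[0, T]`, so two-sided derivatives are available only away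
  -- from the endpoints, which form a null set.
  have h0 : ∀ᵐ x : ℝ, x ≠ 0 := by simp [ae_iff, measure_singleton]
  have h1 : ∀ᵐ x : ℝ, x ≠ T := by simp [ae_iff, measure_singleton]
  filter_upwards [hint.ae_hasDerivAt_integral, h0, h1] with x hx hx0 hxT hxm
  refine ((hx hxm 0 left_mem_uIcc).const_add (f 0)).congr_of_eventuallyEq ?_
  rw [uIcc_of_le hT] at hxm
  filter_upwards [Icc_mem_nhds (lt_of_le_of_ne hxm.1 hx0.symm) (lt_of_le_of_ne hxm.2 hxT)]
    with y hy using h y hy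

end HasACDerivOn

/-! ### Maximum principle for the transport equation. -/

/-- Moving from a maximum towards a point of the convex set cannot increase the function; this
one-sided Fermat rule treats interior and boundary maxima together. -/
theorem IsMaxOn.sub_mul_deriv_nonpos {f : ℝ → ℝ} {f' x y : ℝ} {s : Set ℝ} (h : IsMaxOn f s x)
    (hs : Convex ℝ s) (hx : x ∈ s) (hy : y ∈ s) (hf : HasDerivWithinAt f f' s x) :
    (y - x) * f' ≤ 0 := by
  have := h.localize.hasFDerivWithinAt_nonpos hf.hasFDerivWithinAt
    (sub_mem_posTangentConeAt_of_segment_subset (hs.segment_subset hx hy))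
  simpa using this

/-- The minimum is monotone and 1-Lipschitz with weights summing to one; this linearises the
nonlinear term of the fluid equation. -/
theorem exists_min_sub_min (x₁ y₁ x₂ y₂ : ℝ) : ∃ κ ∈ Icc (0 : ℝ) 1,
    min x₁ y₁ - min x₂ y₂ = (1 - κ) * (x₁ - x₂) + κ * (y₁ - y₂) := by
  have key : ∀ u v w : ℝ, u ≤ w → w ≤ v → ∃ κ ∈ Icc (0 : ℝ) 1, w = (1 - κ) * u + κ * v := by
    intro u v w h1 h2
    obtain ⟨a, b, ha, hb, hab, h⟩ :=
      (segment_eq_Icc (h1.trans h2) ▸ ⟨h1, h2⟩ : w ∈ segment ℝ u v)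
    refine ⟨b, ⟨hb, by linarith⟩, ?_⟩
    rw [← h, ← hab]; simp
  rcases le_total x₁ y₁ with h1 | h1 <;> rcases le_total x₂ y₂ with h2 | h2
  · exact ⟨0, by simp, by simp [h1, h2]⟩
  · rw [min_eq_left h1, min_eq_right h2]
    exact key _ _ _ (by linarith) (by linarith)
  · rw [min_eq_right h1, min_eq_left h2]
    obtain ⟨κ, hκ, h⟩ := key (y₁ - y₂) (x₁ - x₂) (y₁ - x₂) (by linarith) (by linarith)
    exact ⟨1 - κ, ⟨by linarith [hκ.2], by linarith [hκ.1]⟩, by rw [h]; ring⟩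
  · exact ⟨1, by simp, by simp [h1, h2]⟩

/-- A maximum principle for `∂V/∂t ≤ a (e^{-α} - 1) ∂V/∂α + B V` with `a ≥ 0`, on a rectangle
`[0, T] × [p, q]` with `p ≤ 0 ≤ q`. -/
theorem transport_maximum_principle {p q T B : ℝ} (hp : p ≤ 0) (hq : 0 ≤ q)
    {V Vt Vα : ℝ → ℝ → ℝ}
    (hcont : ContinuousOn (Function.uncurry V) (Icc 0 T ×ˢ Icc p q))
    (h0 : ∀ α ∈ Icc p q, V 0 α ≤ 0)
    (ht : ∀ t ∈ Icc 0 T, ∀ α ∈ Icc p q,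
      HasDerivWithinAt (fun s => V s α) (Vt t α) (Icc 0 T) t)
    (hα : ∀ t ∈ Icc 0 T, ∀ α ∈ Icc p q, HasDerivWithinAt (V t) (Vα t α) (Icc p q) α)
    (hineq : ∀ t ∈ Icc 0 T, ∀ α ∈ Icc p q, 0 < V t α →
      ∃ a, 0 ≤ a ∧ Vt t α ≤ a * (Real.exp (-α) - 1) * Vα t α + B * V t α) :
    ∀ t ∈ Icc 0 T, ∀ α ∈ Icc p q, V t α ≤ 0 := by
  intro t₀ ht₀ α₀ hα₀
  by_contra! hpos
  -- Discounting at rate `B + 1` instead of `B` leaves the strict margin `V` that gives the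
  -- contradiction at the maximum.
  have hcW : ContinuousOn (fun z : ℝ × ℝ => Real.exp (-(B + 1) * z.1) * V z.1 z.2)
      (Icc 0 T ×ˢ Icc p q) := by
    refine ContinuousOn.mul (by fun_prop) hcont
  obtain ⟨⟨t, α⟩, ⟨htm, hαm⟩, hmax⟩ := (isCompact_Icc.prod isCompact_Icc).exists_isMaxOn
    ⟨(t₀, α₀), ht₀, hα₀⟩ hcW
  simp only at htm hαm
  have hE := Real.exp_pos (-(B + 1) * t)
  have hV : 0 < V t α := by
    have h1 : Real.exp (-(B + 1) * t₀) * V t₀ α₀ ≤ Real.exp (-(B + 1) * t) * V t α :=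
      hmax (show (t₀, α₀) ∈ _ from ⟨ht₀, hα₀⟩)
    have h2 := mul_pos (Real.exp_pos (-(B + 1) * t₀)) hpos
    exact pos_of_mul_pos_right (h2.trans_le h1) hE.le
  have htpos : 0 < t := lt_of_le_of_ne htm.1 fun h => by
    subst h; exact absurd (h0 α hαm) (not_le.2 hV)
  have hmα : IsMaxOn (V t) (Icc p q) α := fun β hβ => by
    have : Real.exp (-(B + 1) * t) * V t β ≤ Real.exp (-(B + 1) * t) * V t α :=
      hmax (show (t, β) ∈ _ from ⟨htm, hβ⟩)
    exact le_of_mul_le_mul_left this hE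
  -- Comparing with the point `0` of `[p, q]` gives `α Vα ≥ 0`, hence `(e^{-α} - 1) Vα ≤ 0`, even at
  -- the ends of the interval.
  have h1 := hmα.sub_mul_deriv_nonpos (convex_Icc p q) hαm ⟨hp, hq⟩ (hα t htm α hαm)
  have hmt : IsMaxOn (fun s => Real.exp (-(B + 1) * s) * V s α) (Icc 0 T) t := fun s hs =>
    hmax (show (s, α) ∈ _ from ⟨hs, hαm⟩)
  have hder : HasDerivWithinAt (fun s => Real.exp (-(B + 1) * s) * V s α)
      (Real.exp (-(B + 1) * t) * (-(B + 1)) * V t α + Real.exp (-(B + 1) * t) * Vt t α)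
      (Icc 0 T) t := by
    have : HasDerivAt (fun s : ℝ => Real.exp (-(B + 1) * s))
        (Real.exp (-(B + 1) * t) * (-(B + 1))) t := by
      simpa using ((hasDerivAt_id t).const_mul (-(B + 1))).exp
    exact this.hasDerivWithinAt.mul (ht t htm α hαm)
  have h2 := hmt.sub_mul_deriv_nonpos (convex_Icc 0 T) htm ⟨le_rfl, htm.1.trans htm.2⟩ hder
  have h3 : 0 ≤ Vt t α - (B + 1) * V t α := by
    have : 0 ≤ t * (Real.exp (-(B + 1) * t) * (Vt t α - (B + 1) * V t α)) := by linarith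
    exact nonneg_of_mul_nonneg_right (nonneg_of_mul_nonneg_right this htpos) hE
  obtain ⟨a, ha, hle⟩ := hineq t htm α hαm hV
  have h4 : (Real.exp (-α) - 1) * Vα t α ≤ 0 := by
    rcases lt_trichotomy α 0 with h | h | h
    · have hexp : 1 < Real.exp (-α) := Real.one_lt_exp_iff.2 (by linarith)
      have : Vα t α ≤ 0 := by nlinarith
      nlinarith
    · simp [h]
    · have hexp : Real.exp (-α) < 1 := Real.exp_lt_one_iff.2 (by linarith)
      have : 0 ≤ Vα t α := by nlinarith
      nlinarith
  nlinarith [mul_nonneg ha (neg_nonneg.2 h4)]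

/-! ### Integrating factor and uniqueness of fluid MGFs. -/

/-- Variation of constants: the integrating factor of an equation integrated in time. -/
theorem exp_mul_eq_of_integral_eq {lam w g : ℝ → ℝ} {k w₀ T : ℝ}
    (hlam : IntervalIntegrable lam volume 0 T)
    (hw : ContinuousOn w (Icc 0 T)) (hg : ContinuousOn g (Icc 0 T))
    (h : ∀ t ∈ Icc 0 T, w t = w₀ + ∫ s in (0 : ℝ)..t, (lam s * k * w s + g s))
    {t : ℝ} (ht : t ∈ Icc 0 T) :
    Real.exp (-k * ∫ s in (0 : ℝ)..t, lam s) * w t =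
      w₀ + ∫ s in (0 : ℝ)..t, Real.exp (-k * ∫ r in (0 : ℝ)..s, lam r) * g s := by
  have hsub : uIcc 0 t ⊆ Icc 0 T := by rw [uIcc_of_le ht.1]; exact Icc_subset_Icc_right ht.2
  have hlt : IntervalIntegrable lam volume 0 t :=
    hlam.mono_set (by rwa [uIcc_of_le (ht.1.trans ht.2)])
  have hw0 : w 0 = w₀ := by simpa using h 0 ⟨le_rfl, ht.1.trans ht.2⟩
  have hW : HasACDerivOn w (fun s => lam s * k * w s + g s) t := by
    refine .of_integral ht.1 ?_ fun s hs => by rw [hw0]; exact h s ⟨hs.1, hs.2.trans ht.2⟩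
    exact ((hlt.mul_const k).mul_continuousOn (hw.mono hsub)).add
      (hg.mono hsub).intervalIntegrable
  have hL : HasACDerivOn (fun s => ∫ r in (0 : ℝ)..s, lam r) lam t :=
    .of_integral ht.1 hlt fun s _ => by simp
  have hP := ((hL.const_mul (-k)).exp).mul hW
  have := hP.integral_eq
  simp only [intervalIntegral.integral_same, mul_zero, Real.exp_zero, one_mul, hw0] at this
  rw [← sub_eq_iff_eq_add', ← this]
  exact intervalIntegral.integral_congr fun s _ => by ring

theorem hasDerivWithinAt_integral_Icc {g : ℝ → ℝ} {T t : ℝ} (hg : ContinuousOn g (Icc 0 T))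
    (ht : t ∈ Icc 0 T) :
    HasDerivWithinAt (fun u => ∫ s in (0 : ℝ)..u, g s) (g t) (Icc 0 T) t := by
  have : Fact (t ∈ Icc 0 T) := ⟨ht⟩
  have hsub : uIcc 0 t ⊆ Icc 0 T := by rw [uIcc_of_le ht.1]; exact Icc_subset_Icc_right ht.2
  exact intervalIntegral.integral_hasDerivWithinAt_right
    (hg.mono hsub).intervalIntegrable
    (hg.stronglyMeasurableAtFilter_nhdsWithin measurableSet_Icc t) (hg t ht)

theorem continuousOn_integral_Icc {f : ℝ → ℝ} {T : ℝ} (hT : 0 ≤ T)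
    (hf : IntervalIntegrable f volume 0 T) :
    ContinuousOn (fun t => ∫ s in (0 : ℝ)..t, f s) (Icc 0 T) := by
  have := intervalIntegral.continuousOn_primitive_interval' hf left_mem_uIcc
  rwa [uIcc_of_le hT] at this

namespace IsFluidMGF

variable {lam : ℝ → ℝ} {c μ θ q₀ : ℝ} {I J : Set ℝ} {M M₁ M₂ : ℝ → ℝ → ℝ}

theorem mono (h : IsFluidMGF lam c μ θ q₀ I M) (hJ : J ⊆ I) : IsFluidMGF lam c μ θ q₀ J M := by
  obtain ⟨D, h1, h2, h3, h4⟩ := h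
  exact ⟨D, h1.mono (prod_mono_right hJ), h2.mono (prod_mono_right hJ),
    fun t ht α hα => (h3 t ht α (hJ hα)).mono hJ, fun t ht α hα => h4 t ht α (hJ hα)⟩

/-- The integrating factor removes the term in `lam`, which makes the difference classically
differentiable in time, as the maximum principle requires. -/
theorem le_of_Icc {p q : ℝ} (hp : p ≤ 0) (hq : 0 ≤ q) (hμ : 0 ≤ μ) (hθ : 0 ≤ θ)
    (hlam : ∀ T, 0 ≤ T → IntervalIntegrable lam volume 0 T)
    (h₁ : IsFluidMGF lam c μ θ q₀ (Icc p q) M₁) (h₂ : IsFluidMGF lam c μ θ q₀ (Icc p q) M₂)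
    {T α : ℝ} (hT : 0 ≤ T) (hα : α ∈ Icc p q) : M₁ T α ≤ M₂ T α := by
  obtain ⟨D₁, cM₁, cD₁, hD₁, e₁⟩ := h₁
  obtain ⟨D₂, cM₂, cD₂, hD₂, e₂⟩ := h₂
  have hsub : Icc 0 T ×ˢ Icc p q ⊆ Ici 0 ×ˢ Icc p q := prod_mono_left Icc_subset_Ici_self
  have slice : ∀ {F : ℝ → ℝ → ℝ}, ContinuousOn (Function.uncurry F) (Ici 0 ×ˢ Icc p q) →
      ∀ β ∈ Icc p q, ContinuousOn (fun t => F t β) (Icc 0 T) := fun hF β hβ =>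
    hF.comp (f := fun t : ℝ => (t, β)) (by fun_prop) fun t ht => ⟨ht.1, hβ⟩
  have cΛ := continuousOn_integral_Icc hT (hlam T hT)
  set Λ : ℝ → ℝ := fun t => ∫ s in (0 : ℝ)..t, lam s with hΛ
  obtain ⟨L, hL⟩ := isCompact_Icc.exists_bound_of_continuousOn cΛ
  have hL0 : 0 ≤ L := (norm_nonneg _).trans (hL 0 ⟨le_rfl, hT⟩)
  set W : ℝ → ℝ → ℝ := fun t β => M₁ t β - M₂ t β with hW
  set m : ℝ → ℝ → ℝ := fun t β => min (D₁ t β) (c * M₁ t β) - min (D₂ t β) (c * M₂ t β) with hm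
  set G : ℝ → ℝ → ℝ := fun t β => (Real.exp (-β) - 1) *
    (θ * (D₁ t β - D₂ t β) - (θ - μ) * m t β) with hG
  have cG : ∀ β ∈ Icc p q, ContinuousOn (fun t => G t β) (Icc 0 T) := fun β hβ => by
    have := slice cM₁ β hβ
    have := slice cM₂ β hβ
    have := slice cD₁ β hβ
    have := slice cD₂ β hβ
    fun_prop
  have cW : ∀ β ∈ Icc p q, ContinuousOn (fun t => W t β) (Icc 0 T) := fun β hβ =>
    (slice cM₁ β hβ).sub (slice cM₂ β hβ)
  have eW : ∀ β ∈ Icc p q, ∀ t ∈ Icc 0 T,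
      W t β = 0 + ∫ s in (0 : ℝ)..t, (lam s * (Real.exp β - 1) * W s β + G s β) := by
    intro β hβ t ht
    have hsub' : uIcc 0 t ⊆ Icc 0 T := by
      rw [uIcc_of_le ht.1]; exact Icc_subset_Icc_right ht.2
    have hint : ∀ {M D : ℝ → ℝ → ℝ}, ContinuousOn (Function.uncurry M) (Ici 0 ×ˢ Icc p q) →
        ContinuousOn (Function.uncurry D) (Ici 0 ×ˢ Icc p q) →
        IntervalIntegrable (fun s => lam s * (Real.exp β - 1) * M s β
          + θ * (Real.exp (-β) - 1) * D s β
          - (θ - μ) * (Real.exp (-β) - 1) * min (D s β) (c * M s β)) volume 0 t := by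
      intro M D hM hD
      have h1 := (slice hM β hβ).mono hsub'
      have h2 := (slice hD β hβ).mono hsub'
      refine ((((hlam t ht.1).mul_const _).mul_continuousOn h1).add
        (ContinuousOn.intervalIntegrable ?_)).sub (ContinuousOn.intervalIntegrable ?_)
      · fun_prop
      · fun_prop
    simp only [hW]
    rw [e₁ t ht.1 β hβ, e₂ t ht.1 β hβ, add_sub_add_left_eq_sub, zero_add,
      ← intervalIntegral.integral_sub (hint cM₁ cD₁) (hint cM₂ cD₂)]
    refine intervalIntegral.integral_congr fun s _ => ?_
    simp only [hG, hm]; ring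
  set V : ℝ → ℝ → ℝ := fun t β => Real.exp (-(Real.exp β - 1) * Λ t) * W t β with hV
  have eV : ∀ β ∈ Icc p q, ∀ t ∈ Icc 0 T, V t β =
      ∫ s in (0 : ℝ)..t, Real.exp (-(Real.exp β - 1) * Λ s) * G s β := by
    intro β hβ t ht
    rw [← zero_add (∫ s in (0 : ℝ)..t, _)]
    exact exp_mul_eq_of_integral_eq (hlam T hT) (cW β hβ) (cG β hβ) (eW β hβ) ht
  have key : ∀ t ∈ Icc 0 T, ∀ β ∈ Icc p q, V t β ≤ 0 := by
    refine transport_maximum_principle (Vt := fun t β => Real.exp (-(Real.exp β - 1) * Λ t) * G t β)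
      (Vα := fun t β => Real.exp (-(Real.exp β - 1) * Λ t) * (-Real.exp β * Λ t) * W t β +
        Real.exp (-(Real.exp β - 1) * Λ t) * (D₁ t β - D₂ t β))
      (B := (Real.exp (-p) + 1) * ((θ + μ) * Real.exp q * L + (θ + μ) * |c|)) hp hq ?_ ?_ ?_ ?_ ?_
    · have : ContinuousOn (fun z : ℝ × ℝ => Λ z.1) (Icc 0 T ×ˢ Icc p q) :=
        cΛ.comp continuousOn_fst fun z hz => hz.1
      exact (Real.continuous_exp.comp_continuousOn (ContinuousOn.mul (by fun_prop) this)).mul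
        ((cM₁.mono hsub).sub (cM₂.mono hsub))
    · intro β hβ
      rw [eV β hβ 0 ⟨le_rfl, hT⟩]; simp
    · intro t ht β hβ
      have hc : ContinuousOn (fun s => Real.exp (-(Real.exp β - 1) * Λ s) * G s β) (Icc 0 T) :=
        ContinuousOn.mul (by fun_prop) (cG β hβ)
      exact (hasDerivWithinAt_integral_Icc hc ht).congr (fun s hs => eV β hβ s hs) (eV β hβ t ht)
    · intro t ht β hβ
      have h1 : HasDerivAt (fun b : ℝ => Real.exp (-(Real.exp b - 1) * Λ t))
          (Real.exp (-(Real.exp β - 1) * Λ t) * (-Real.exp β * Λ t)) β :=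
        (((Real.hasDerivAt_exp β).sub_const 1).neg.mul_const (Λ t)).exp
      exact h1.hasDerivWithinAt.mul ((hD₁ t ht.1 β hβ).sub (hD₂ t ht.1 β hβ))
    · intro t ht β hβ hpos
      obtain ⟨κ, ⟨hκ0, hκ1⟩, hκ⟩ :=
        exists_min_sub_min (D₁ t β) (c * M₁ t β) (D₂ t β) (c * M₂ t β)
      have ha0 : 0 ≤ θ * κ + μ * (1 - κ) :=
        add_nonneg (mul_nonneg hθ hκ0) (mul_nonneg hμ (by linarith))
      -- This is the coefficient of `D₁ - D₂` left once `(θ - μ)(1 - κ)` is subtracted from `θ`.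
      refine ⟨θ * κ + μ * (1 - κ), ha0, ?_⟩
      set E := Real.exp (-(Real.exp β - 1) * Λ t)
      -- This bounds the zeroth-order coefficient; its part with `Λ` comes from differentiating the
      -- integrating factor in `β`.
      have hb : (Real.exp (-β) - 1) *
          ((θ * κ + μ * (1 - κ)) * Real.exp β * Λ t - (θ - μ) * κ * c) ≤
          (Real.exp (-p) + 1) * ((θ + μ) * Real.exp q * L + (θ + μ) * |c|) := by
        refine (le_abs_self _).trans ?_
        rw [abs_mul]
        refine mul_le_mul ?_ ?_ (abs_nonneg _) (by positivity)
        · have := Real.exp_le_exp.2 (neg_le_neg hβ.1)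
          have := Real.exp_pos (-β)
          exact abs_le.2 ⟨by linarith, by linarith⟩
        · refine (abs_sub _ _).trans (add_le_add ?_ ?_)
          · rw [abs_mul, abs_mul, abs_of_nonneg ha0, Real.abs_exp]
            have hle : θ * κ + μ * (1 - κ) ≤ θ + μ := by nlinarith
            have := Real.exp_le_exp.2 hβ.2
            have := hL t ht
            rw [Real.norm_eq_abs] at this
            gcongr
          · rw [abs_mul, abs_mul, abs_of_nonneg hκ0]
            have h1 : |θ - μ| ≤ θ + μ := abs_le.2 ⟨by linarith, by linarith⟩
            have h2 : |θ - μ| * κ ≤ θ + μ := by nlinarith [abs_nonneg (θ - μ)]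
            gcongr
      have hVb := mul_le_mul_of_nonneg_right hb hpos.le
      refine le_trans (le_of_eq ?_) (add_le_add_right hVb _)
      simp only [hG, hm, hκ, hV, hW]
      ring
  have := key T ⟨hT, le_rfl⟩ α hα
  have := nonpos_of_mul_nonpos_right this (Real.exp_pos _)
  simpa [hW] using this

/-- Only the segment from `0` to `α` matters, so the two solutions may live on different intervals.
-/
theorem eq_of_ordConnected (hμ : 0 ≤ μ) (hθ : 0 ≤ θ)
    (hlam : ∀ T, 0 ≤ T → IntervalIntegrable lam volume 0 T)
    (h₁ : IsFluidMGF lam c μ θ q₀ I M₁) (h₂ : IsFluidMGF lam c μ θ q₀ J M₂)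
    (hI : I.OrdConnected) (hJ : J.OrdConnected) (hI0 : 0 ∈ I) (hJ0 : 0 ∈ J)
    {T α : ℝ} (hT : 0 ≤ T) (hαI : α ∈ I) (hαJ : α ∈ J) : M₁ T α = M₂ T α := by
  have h₁' := h₁.mono (hI.uIcc_subset hI0 hαI)
  have h₂' := h₂.mono (hJ.uIcc_subset hJ0 hαJ)
  have hmem : α ∈ uIcc 0 α := right_mem_uIcc
  exact le_antisymm (le_of_Icc inf_le_left le_sup_left hμ hθ hlam h₁' h₂' hT hmem)
    (le_of_Icc inf_le_left le_sup_left hμ hθ hlam h₂' h₁' hT hmem)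

end IsFluidMGF

/-- Taking `μ = θ` kills the nonlinear term, so uniqueness for the queue is a special case of the
fluid one. -/
theorem IsMMInfMGF.isFluidMGF {lam : ℝ → ℝ} {θ x₀ : ℝ} {N : ℝ → ℝ → ℝ} (c : ℝ)
    (h : IsMMInfMGF lam θ x₀ N) : IsFluidMGF lam c θ θ x₀ univ N := by
  obtain ⟨D, h1, h2, h3, h4⟩ := h
  refine ⟨D, h1, h2, fun t ht α _ => (h3 t ht α).hasDerivWithinAt, fun t ht α _ => ?_⟩
  simpa using h4 t ht α

theorem IsMMInfMGF.unique {lam : ℝ → ℝ} {θ x₀ : ℝ} {N₁ N₂ : ℝ → ℝ → ℝ} (hθ : 0 ≤ θ)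
    (hlam : ∀ T, 0 ≤ T → IntervalIntegrable lam volume 0 T)
    (h₁ : IsMMInfMGF lam θ x₀ N₁) (h₂ : IsMMInfMGF lam θ x₀ N₂) {T : ℝ} (hT : 0 ≤ T) (α : ℝ) :
    N₁ T α = N₂ T α :=
  (h₁.isFluidMGF 0).eq_of_ordConnected hθ hθ hlam (h₂.isFluidMGF 0) ordConnected_univ
    ordConnected_univ trivial trivial hT trivial trivial

/-! ### The explicit `M/M/∞` moment generating function. -/

/-- The mean at time `t` of the `M/M/∞` queue that starts empty. -/
noncomputable def mmInfMean (lam : ℝ → ℝ) (θ t : ℝ) : ℝ :=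
  Real.exp (-θ * t) * ∫ s in (0 : ℝ)..t, Real.exp (θ * s) * lam s

/-- The moment generating function at `α`, at time `t`, of the indicator that a customer present at
time `0` is still present. -/
noncomputable def survivalMGF (θ t α : ℝ) : ℝ := 1 + (Real.exp α - 1) * Real.exp (-θ * t)

/-- The moment generating function of the `M/M/∞` queue with real initial value `x₀`. -/
noncomputable def mmInfMGF (lam : ℝ → ℝ) (θ x₀ t α : ℝ) : ℝ :=
  Real.exp ((Real.exp α - 1) * mmInfMean lam θ t + x₀ * Real.log (survivalMGF θ t α))

/-- The derivative in `α` of the logarithm of `mmInfMGF`. -/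
noncomputable def mmInfLogDeriv (lam : ℝ → ℝ) (θ x₀ t α : ℝ) : ℝ :=
  Real.exp α * mmInfMean lam θ t + x₀ * (Real.exp α * Real.exp (-θ * t) / survivalMGF θ t α)

section

variable {lam : ℝ → ℝ} {θ x₀ T t α : ℝ}

/-- It is a convex combination of `1` and `e^α`; positivity makes its real powers, written with the
logarithm, meaningful. -/
theorem survivalMGF_pos (hθ : 0 < θ) (ht : 0 ≤ t) : 0 < survivalMGF θ t α := by
  have h1 : Real.exp (-θ * t) ≤ 1 := Real.exp_le_one_iff.2 (by nlinarith)
  have h2 := mul_pos (Real.exp_pos α) (Real.exp_pos (-θ * t))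
  unfold survivalMGF
  rcases h1.lt_or_eq with h | h
  · nlinarith
  · rw [h]; simpa using Real.exp_pos α

theorem intervalIntegrable_exp_mul (hlam : IntervalIntegrable lam volume 0 T) :
    IntervalIntegrable (fun s => Real.exp (θ * s) * lam s) volume 0 T :=
  hlam.continuousOn_mul (by fun_prop)

theorem hasACDerivOn_mmInfMean (hT : 0 ≤ T) (hlam : IntervalIntegrable lam volume 0 T) :
    HasACDerivOn (mmInfMean lam θ) (fun t => lam t - θ * mmInfMean lam θ t) T := by
  have h1 : HasACDerivOn (fun t => Real.exp (-θ * t)) (fun t => Real.exp (-θ * t) * (-θ)) T :=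
    .of_contDiff (by fun_prop) fun x => by
      simpa using ((hasDerivAt_id x).const_mul (-θ)).exp
  have h2 : HasACDerivOn (fun t => ∫ s in (0 : ℝ)..t, Real.exp (θ * s) * lam s)
      (fun t => Real.exp (θ * t) * lam t) T :=
    .of_integral hT (intervalIntegrable_exp_mul hlam) fun s _ => by simp
  refine (h1.mul h2).congr_deriv fun t _ => ?_
  have : Real.exp (-θ * t) * Real.exp (θ * t) = 1 := by rw [← Real.exp_add]; simp
  unfold mmInfMean
  linear_combination lam t * this

theorem continuousOn_mmInfMean (hlam : ∀ T, 0 ≤ T → IntervalIntegrable lam volume 0 T) :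
    ContinuousOn (mmInfMean lam θ) (Ici 0) := by
  intro t ht
  have hT : (0 : ℝ) ≤ t + 1 := by have : (0 : ℝ) ≤ t := ht; linarith
  have := (hasACDerivOn_mmInfMean (θ := θ) hT (hlam _ hT)).1.continuousOn
  rw [uIcc_of_le hT] at this
  refine (this t ⟨ht, by linarith⟩).mono_of_mem_nhdsWithin ?_
  rw [← Ici_inter_Iic]
  exact inter_mem_nhdsWithin _ (Iic_mem_nhds (by linarith))

theorem hasDerivAt_survivalMGF :
    HasDerivAt (survivalMGF θ t) (Real.exp α * Real.exp (-θ * t)) α :=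
  (((Real.hasDerivAt_exp α).sub_const 1).mul_const _).const_add 1

theorem hasDerivAt_mmInfMGF (hθ : 0 < θ) (ht : 0 ≤ t) :
    HasDerivAt (mmInfMGF lam θ x₀ t) (mmInfMGF lam θ x₀ t α * mmInfLogDeriv lam θ x₀ t α) α :=
  ((((Real.hasDerivAt_exp α).sub_const 1).mul_const _).add
    ((hasDerivAt_survivalMGF.log (survivalMGF_pos hθ ht).ne').const_mul x₀)).exp

theorem continuousOn_mmInfMGF (hθ : 0 < θ) (hlam : ∀ T, 0 ≤ T → IntervalIntegrable lam volume 0 T) :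
    ContinuousOn (Function.uncurry (mmInfMGF lam θ x₀)) (Ici 0 ×ˢ univ) := by
  have h1 : ContinuousOn (fun z : ℝ × ℝ => mmInfMean lam θ z.1) (Ici 0 ×ˢ univ) :=
    (continuousOn_mmInfMean hlam).comp continuousOn_fst fun z hz => hz.1
  have h2 : ContinuousOn (fun z : ℝ × ℝ => survivalMGF θ z.1 z.2) (Ici 0 ×ˢ univ) := by
    unfold survivalMGF; fun_prop
  have h3 := h2.log fun z hz => (survivalMGF_pos hθ hz.1).ne'
  unfold mmInfMGF Function.uncurry
  exact Real.continuous_exp.comp_continuousOn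
    ((ContinuousOn.mul (by fun_prop) h1).add (h3.const_mul x₀))

theorem continuousOn_mmInfLogDeriv (hθ : 0 < θ)
    (hlam : ∀ T, 0 ≤ T → IntervalIntegrable lam volume 0 T) :
    ContinuousOn (Function.uncurry (mmInfLogDeriv lam θ x₀)) (Ici 0 ×ˢ univ) := by
  have h1 : ContinuousOn (fun z : ℝ × ℝ => mmInfMean lam θ z.1) (Ici 0 ×ˢ univ) :=
    (continuousOn_mmInfMean hlam).comp continuousOn_fst fun z hz => hz.1
  have h2 : ContinuousOn (fun z : ℝ × ℝ => survivalMGF θ z.1 z.2) (Ici 0 ×ˢ univ) := by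
    unfold survivalMGF; fun_prop
  unfold mmInfLogDeriv Function.uncurry
  exact (ContinuousOn.mul (by fun_prop) h1).add (continuousOn_const.mul
    (ContinuousOn.div (by fun_prop) h2 fun z hz => (survivalMGF_pos hθ hz.1).ne'))

theorem hasACDerivOn_log_survivalMGF (hθ : 0 < θ) (hT : 0 ≤ T) :
    HasACDerivOn (fun t => Real.log (survivalMGF θ t α))
      (fun t => (Real.exp α - 1) * (Real.exp (-θ * t) * (-θ)) / survivalMGF θ t α) T := by
  have hd : ∀ t, HasDerivAt (fun t => survivalMGF θ t α)
      ((Real.exp α - 1) * (Real.exp (-θ * t) * (-θ))) t := fun t => by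
    have : HasDerivAt (fun t => Real.exp (-θ * t)) (Real.exp (-θ * t) * (-θ)) t := by
      simpa using ((hasDerivAt_id t).const_mul (-θ)).exp
    exact (this.const_mul _).const_add 1
  have hd' : ∀ t ∈ uIcc 0 T, HasDerivAt (fun t => Real.log (survivalMGF θ t α))
      ((Real.exp α - 1) * (Real.exp (-θ * t) * (-θ)) / survivalMGF θ t α) t := fun t ht => by
    rw [uIcc_of_le hT] at ht
    exact (hd t).log (survivalMGF_pos hθ ht.1).ne'
  refine ⟨ContDiffOn.absolutelyContinuousOnInterval ?_, .of_forall hd'⟩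
  refine ContDiffOn.log (by unfold survivalMGF; fun_prop) fun t ht => ?_
  rw [uIcc_of_le hT] at ht
  exact (survivalMGF_pos hθ ht.1).ne'

/-- In the exponent, `log survivalMGF` solves the homogeneous transport equation and `(e^α - 1)
mmInfMean` the one with source `lam (e^α - 1)`; exponentiating and integrating gives the claim. -/
theorem isMMInfMGF_mmInfMGF (hθ : 0 < θ)
    (hlam : ∀ T, 0 ≤ T → IntervalIntegrable lam volume 0 T) :
    IsMMInfMGF lam θ x₀ (mmInfMGF lam θ x₀) := by
  refine ⟨fun t α => mmInfMGF lam θ x₀ t α * mmInfLogDeriv lam θ x₀ t α,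
    continuousOn_mmInfMGF hθ hlam,
    (continuousOn_mmInfMGF hθ hlam).mul (continuousOn_mmInfLogDeriv hθ hlam),
    fun t ht α => hasDerivAt_mmInfMGF hθ ht, fun t ht α => ?_⟩
  have h := ((((hasACDerivOn_mmInfMean (θ := θ) ht (hlam t ht)).const_mul (Real.exp α - 1)).add
    ((hasACDerivOn_log_survivalMGF (α := α) hθ ht).const_mul x₀)).exp).integral_eq
  have h0 : mmInfMGF lam θ x₀ 0 α = Real.exp (α * x₀) := by
    simp [mmInfMGF, mmInfMean, survivalMGF, mul_comm]
  rw [← h0]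
  refine (sub_eq_iff_eq_add'.1 (h.symm.trans ?_))
  refine intervalIntegral.integral_congr fun s hs => ?_
  rw [uIcc_of_le ht] at hs
  have hS := (survivalMGF_pos (α := α) hθ hs.1).ne'
  have he : Real.exp (-α) * Real.exp α = 1 := by rw [← Real.exp_add]; simp
  simp only
  change mmInfMGF lam θ x₀ s α * _ = _
  unfold mmInfLogDeriv
  field_simp
  ring_nf
  linear_combination (-mmInfMGF lam θ x₀ s α * (mmInfMean lam θ s * θ * survivalMGF θ s α
    + θ * x₀ * Real.exp (-(θ * s)))) * he

/-! ### The linear regime of the fluid equation. -/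

theorem le_mmInfMean {l : ℝ} (hθ : 0 < θ) (ht : 0 ≤ t) (hlam : IntervalIntegrable lam volume 0 t)
    (hl : ∀ s, 0 ≤ s → l ≤ lam s) : l / θ * (1 - Real.exp (-θ * t)) ≤ mmInfMean lam θ t := by
  have h1 : ∫ s in (0 : ℝ)..t, Real.exp (θ * s) * l = (Real.exp (θ * t) - 1) / θ * l := by
    rw [intervalIntegral.integral_mul_const, intervalIntegral.integral_comp_mul_left
      (fun x => Real.exp x) hθ.ne', integral_exp]
    simp only [mul_zero, Real.exp_zero, smul_eq_mul]; field_simp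
  have h2 : ∫ s in (0 : ℝ)..t, Real.exp (θ * s) * l ≤
      ∫ s in (0 : ℝ)..t, Real.exp (θ * s) * lam s :=
    intervalIntegral.integral_mono_on ht (Continuous.intervalIntegrable (by fun_prop) _ _)
      (intervalIntegrable_exp_mul hlam) fun s hs =>
        mul_le_mul_of_nonneg_left (hl s hs.1) (Real.exp_pos _).le
  have h3 : Real.exp (-θ * t) * Real.exp (θ * t) = 1 := by rw [← Real.exp_add]; simp
  unfold mmInfMean
  refine le_trans (le_of_eq ?_) (mul_le_mul_of_nonneg_left h2 (Real.exp_pos _).le)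
  rw [h1]
  rw [neg_mul] at h3 ⊢
  field_simp
  linear_combination (-l) * h3

/-- The drift of the queue in state `κ` is positive and it starts above `κ`, so that the logarithmic
derivative of its moment generating function stays above `κ` near `0`. -/
theorem exists_le_mmInfLogDeriv {l κ : ℝ} (hθ : 0 < θ) (hκ : 0 < κ) (hκl : κ < l / θ) (hκx : κ < x₀)
    (hlam : ∀ T, 0 ≤ T → IntervalIntegrable lam volume 0 T) (hl : ∀ s, 0 ≤ s → l ≤ lam s) :
    ∃ δ, 0 < δ ∧ ∀ t, 0 ≤ t → ∀ α, -δ < α → κ ≤ mmInfLogDeriv lam θ x₀ t α := by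
  -- The gap between `κ` and `b` pays for the factor `e^α < 1` at negative `α`; it is used up at
  -- `e^α = κ / b`, which fixes `δ`.
  obtain ⟨b, hκb, hb⟩ := exists_between (lt_min hκl hκx)
  have hb0 : 0 < b := hκ.trans hκb
  refine ⟨Real.log (b / κ), Real.log_pos ((one_lt_div hκ).2 hκb), fun t ht α hα => ?_⟩
  have hexp : κ / b ≤ Real.exp α := by
    rw [← Real.log_le_iff_le_exp (by positivity), ← inv_div, Real.log_inv]
    exact hα.le
  have hm := le_mmInfMean hθ ht (hlam t ht) hl
  set e := Real.exp (-θ * t) with he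
  have he0 : 0 < e := Real.exp_pos _
  have he1 : e ≤ 1 := Real.exp_le_one_iff.2 (by nlinarith)
  have hbl : b < l / θ := hb.trans_le (min_le_left _ _)
  have hbx : b < x₀ := hb.trans_le (min_le_right _ _)
  have hm' : b * (1 - e) ≤ mmInfMean lam θ t :=
    (mul_le_mul_of_nonneg_right hbl.le (by linarith)).trans hm
  have hS := survivalMGF_pos (α := α) hθ ht
  have hE := Real.exp_pos α
  have hx : b * (Real.exp α * e / survivalMGF θ t α) ≤
      x₀ * (Real.exp α * e / survivalMGF θ t α) :=
    mul_le_mul_of_nonneg_right hbx.le (by positivity)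
  have hcomb : b * Real.exp α * (1 - e) + b * (Real.exp α * e / survivalMGF θ t α) ≤
      mmInfLogDeriv lam θ x₀ t α := by
    unfold mmInfLogDeriv
    refine add_le_add ?_ hx
    nlinarith
  refine le_trans ?_ hcomb
  have hκb' : κ ≤ b * Real.exp α := by rwa [div_le_iff₀' hb0] at hexp
  have hSdef : survivalMGF θ t α = 1 + (Real.exp α - 1) * e := rfl
  -- With `S` the survival MGF, the bound is `b e^α (1 - e + e / S)`: for `α ≤ 0`, `S ≤ 1` gives `b
  -- e^α ≥ κ`, and for `α ≥ 0`, `e^α / S ≥ 1` gives `b`.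
  rcases le_total (Real.exp α) 1 with h1 | h1
  · have hS1 : survivalMGF θ t α ≤ 1 := by rw [hSdef]; nlinarith
    have : Real.exp α * e ≤ Real.exp α * e / survivalMGF θ t α :=
      le_div_self (by positivity) hS hS1
    nlinarith
  · have : e ≤ Real.exp α * e / survivalMGF θ t α := by
      rw [le_div_iff₀ hS, hSdef]
      nlinarith [mul_nonneg (mul_nonneg (sub_nonneg.2 h1) he0.le) (sub_nonneg.2 he1)]
    nlinarith [mul_le_mul_of_nonneg_left this hb0.le,
      mul_nonneg (mul_nonneg hb0.le (sub_nonneg.2 h1)) (sub_nonneg.2 he1)]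

theorem isFluidMGF_exp_mul_mmInfMGF {c μ q₀ γ : ℝ} {I : Set ℝ} (hθ : 0 < θ)
    (hγ : γ = c * (θ - μ) / θ) (hlam : ∀ T, 0 ≤ T → IntervalIntegrable lam volume 0 T)
    (hI : ∀ t, 0 ≤ t → ∀ α ∈ I, c - γ ≤ mmInfLogDeriv lam θ (q₀ - γ) t α) :
    IsFluidMGF lam c μ θ q₀ I (fun t α => Real.exp (α * γ) * mmInfMGF lam θ (q₀ - γ) t α) := by
  set N := mmInfMGF lam θ (q₀ - γ) with hN
  set R := mmInfLogDeriv lam θ (q₀ - γ) with hR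
  have hsub : Ici (0 : ℝ) ×ˢ I ⊆ Ici 0 ×ˢ univ := prod_mono_right (subset_univ _)
  have cN := (continuousOn_mmInfMGF (x₀ := q₀ - γ) hθ hlam).mono hsub
  have cR := (continuousOn_mmInfLogDeriv (x₀ := q₀ - γ) hθ hlam).mono hsub
  refine ⟨fun t α => Real.exp (α * γ) * (N t α * (γ + R t α)),
    ContinuousOn.mul (by fun_prop) cN,
    ContinuousOn.mul (by fun_prop) (cN.mul (continuousOn_const.add cR)), ?_, ?_⟩
  · intro t ht α _
    have h1 : HasDerivAt (fun a : ℝ => Real.exp (a * γ)) (Real.exp (α * γ) * γ) α := by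
      simpa using ((hasDerivAt_id α).mul_const γ).exp
    have h2 : HasDerivAt (N t) (N t α * R t α) α := hasDerivAt_mmInfMGF hθ ht
    exact (h1.mul h2).hasDerivWithinAt.congr_deriv (by ring)
  · intro t ht α hα
    obtain ⟨D, -, -, hD, hint⟩ := isMMInfMGF_mmInfMGF (x₀ := q₀ - γ) hθ hlam
    have hDe : ∀ s, 0 ≤ s → D s α = N s α * R s α := fun s hs =>
      (hD s hs α).unique (hasDerivAt_mmInfMGF hθ hs)
    simp only
    rw [hN, hint t ht α, mul_add, ← Real.exp_add, ← intervalIntegral.integral_const_mul]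
    congr 1
    · rw [← mul_add, add_sub_cancel]
    · refine intervalIntegral.integral_congr fun s hs => ?_
      rw [uIcc_of_le ht] at hs
      have hNpos : 0 < N s α := Real.exp_pos _
      -- The lower bound on the logarithmic derivative decides which branch of the minimum is
      -- active.
      have hmin : c * (Real.exp (α * γ) * N s α) ≤
          Real.exp (α * γ) * (N s α * (γ + R s α)) := by
        have := hI s hs.1 α hα
        nlinarith [mul_pos (Real.exp_pos (α * γ)) hNpos]
      rw [min_eq_right hmin, hDe s hs.1, hN]
      have hγ' : θ * γ = c * (θ - μ) := by rw [hγ]; field_simp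
      linear_combination (-(Real.exp (α * γ) * (Real.exp (-α) - 1) * mmInfMGF lam θ (q₀ - γ) s α))
        * hγ'

theorem analyticOnNhd_mmInfMGF (hθ : 0 < θ) (ht : 0 ≤ t) :
    AnalyticOnNhd ℝ (mmInfMGF lam θ x₀ t) univ := by
  intro α _
  have h1 : AnalyticAt ℝ (survivalMGF θ t) α := by unfold survivalMGF; fun_prop
  have h2 := h1.log (survivalMGF_pos hθ ht)
  unfold mmInfMGF
  fun_prop

end

/-! ### Generating function of the `M/M/∞` law. -/

/-- Agreement on small positive reals identifies the Taylor series of the entire function `G`, which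
converges everywhere. This reaches `z = e^α ≥ 1`, where convergence is not known beforehand. -/
theorem hasSum_of_hasSum_of_differentiable {p : ℕ → ℝ} {g : ℝ → ℝ} {G : ℂ → ℂ}
    (hG : Differentiable ℂ G) (hGg : ∀ x : ℝ, G x = g x) (hp : ∀ n, |p n| ≤ 1)
    (h : ∀ z : ℝ, 0 ≤ z → z < 1 → HasSum (fun n => p n * z ^ n) (g z)) (x : ℝ) :
    HasSum (fun n => p n * x ^ n) (g x) := by
  set q := FormalMultilinearSeries.ofScalars ℂ (fun n => (p n : ℂ)) with hq
  have hqn : ∀ n, ‖q n‖ = |p n| := fun n => by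
    rw [hq, FormalMultilinearSeries.ofScalars_norm]; simp
  have hr : 1 ≤ q.radius := by
    have := q.le_radius_of_bound (r := 1) 1 fun n => by simpa [hqn] using hp n
    simpa using this
  have hqs := q.hasFPowerSeriesOnBall (zero_lt_one.trans_le hr)
  have heq : q.sum =ᶠ[nhds 0] G := by
    refine (hqs.analyticAt.frequently_eq_iff_eventually_eq (hG.analyticAt 0)).1 ?_
    have ht : Filter.Tendsto (fun x : ℝ => (x : ℂ)) (nhdsWithin 0 (Ioi 0)) (nhdsWithin 0 {0}ᶜ) := by
      refine tendsto_nhdsWithin_iff.2 ⟨?_, ?_⟩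
      · exact (Complex.continuous_ofReal.tendsto' 0 0 (by simp)).mono_left nhdsWithin_le_nhds
      · filter_upwards [self_mem_nhdsWithin] with y hy
        have : y ≠ 0 := ne_of_gt hy
        simpa using this
    refine ht.frequently (Filter.Eventually.frequently ?_)
    filter_upwards [Ioo_mem_nhdsGT (zero_lt_one (α := ℝ))] with y hy
    rw [hGg]
    have hs := h y hy.1.le hy.2
    rw [← Complex.hasSum_ofReal] at hs
    refine Eq.trans ?_ hs.tsum_eq
    rw [FormalMultilinearSeries.sum]
    refine tsum_congr fun n => ?_
    simp [hq, mul_comm]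
  have h1 : HasFPowerSeriesAt G q 0 := hqs.hasFPowerSeriesAt.congr heq
  have h2 := hG.hasFPowerSeriesOnBall 0 (R := 1) one_pos
  rw [h2.hasFPowerSeriesAt.eq_formalMultilinearSeries h1] at h2
  have h3 := h2.hasSum (y := (x : ℂ)) (by simp)
  rw [zero_add, hGg, hq] at h3
  rw [← Complex.hasSum_ofReal]
  simpa [FormalMultilinearSeries.ofScalars_apply_eq, mul_comm] using h3

/-- The forward equations weighted along a characteristic: with generating weights `φ ^ n` the increments
transported along the characteristics sum to zero. -/
theorem hasSum_forward_transport {p : ℕ → ℝ} {φ ℓ θ e : ℝ} (hp : ∀ n, |p n| ≤ 1)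
    (h0 : 0 ≤ φ) (h1 : φ < 1) :
    HasSum (fun n : ℕ => ((ℓ * ((if n = 0 then 0 else p (n - 1)) - p n)
          + θ * (((n : ℝ) + 1) * p (n + 1) - n * p n)) * φ ^ n
        + p n * (n * φ ^ (n - 1) * (θ * (φ - 1)))) * e
        + p n * φ ^ n * (e * (-(ℓ * (φ - 1))))) 0 := by
  have hn : ‖φ‖ < 1 := by rwa [Real.norm_of_nonneg h0]
  have s0 : Summable fun n => p n * φ ^ n :=
    .of_norm_bounded (summable_geometric_of_lt_one h0 h1) fun n => by
      rw [norm_mul, norm_pow, Real.norm_of_nonneg h0]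
      exact mul_le_of_le_one_left (pow_nonneg h0 n) (hp n)
  have s1 : Summable fun n : ℕ => ((n : ℝ) + 1) * p (n + 1) * φ ^ n := by
    have := (summable_pow_mul_geometric_of_norm_lt_one 1 hn).add
      (summable_geometric_of_lt_one h0 h1)
    refine .of_norm_bounded this fun n => ?_
    rw [norm_mul, norm_mul, norm_pow, Real.norm_of_nonneg h0,
      Real.norm_of_nonneg (by positivity : (0 : ℝ) ≤ n + 1)]
    have h2 : ‖p (n + 1)‖ ≤ 1 := hp _
    have h3 : 0 ≤ ((n : ℝ) + 1) * φ ^ n := by positivity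
    nlinarith
  obtain ⟨S0, hS0⟩ := s0
  obtain ⟨S1, hS1⟩ := s1
  have a1 : HasSum (fun n : ℕ => (if n = 0 then 0 else p (n - 1)) * φ ^ n) (φ * S0) := by
    rw [← hasSum_nat_add_iff' 1]
    simpa [pow_succ, mul_comm, mul_assoc, mul_left_comm] using hS0.mul_left φ
  -- The truncated exponent at `n = 0` is harmless because of the factor `n`.
  have a2 : HasSum (fun n : ℕ => p n * (n * φ ^ (n - 1))) S1 := by
    rw [← hasSum_nat_add_iff' 1]
    simpa [mul_comm, mul_assoc, mul_left_comm] using hS1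
  have a3 : HasSum (fun n : ℕ => n * p n * φ ^ n) (φ * S1) := by
    rw [← hasSum_nat_add_iff' 1]
    simpa [pow_succ, mul_comm, mul_assoc, mul_left_comm] using hS1.mul_left φ
  have := ((((a1.sub hS0).mul_left (ℓ * e)).add ((hS1.sub a3).mul_left (θ * e))).add
    (a2.mul_left (θ * (φ - 1) * e))).add (hS0.mul_left (-(e * ℓ * (φ - 1))))
  rw [show ℓ * e * (φ * S0 - S0) + θ * e * (S1 - φ * S1) + θ * (φ - 1) * e * S1 +
    -(e * ℓ * (φ - 1)) * S0 = 0 by ring] at this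
  exact this.congr_fun fun n => by ring

namespace IsMMInfLaw

variable {lam : ℝ → ℝ} {θ T : ℝ} {n₀ : ℕ} {P : ℝ → Measure ℕ}

theorem abs_real_le_one (h : IsMMInfLaw lam θ n₀ P) {t : ℝ} (ht : 0 ≤ t) (n : ℕ) :
    |(P t).real {n}| ≤ 1 := by
  have := h.prob t ht
  rw [abs_of_nonneg measureReal_nonneg]
  exact measureReal_le_one

theorem hasSum_pow_of_lt_one (h : IsMMInfLaw lam θ n₀ P) (hθ : 0 < θ) (hT : 0 ≤ T)
    (hlam : IntervalIntegrable lam volume 0 T) {z : ℝ} (hz0 : 0 ≤ z) (hz1 : z < 1) :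
    HasSum (fun n => (P T).real {n} * z ^ n)
      ((1 + (z - 1) * Real.exp (-θ * T)) ^ n₀ * Real.exp ((z - 1) * mmInfMean lam θ T)) := by
  -- This is the characteristic ending at `z` at time `T`. It decreases from `r < 1`, so geometric
  -- series in `r` dominate uniformly in time despite the unbounded death rates.
  set φ : ℝ → ℝ := fun s => 1 + (z - 1) * Real.exp (-θ * (T - s)) with hφ
  set r := 1 + (z - 1) * Real.exp (-θ * T) with hr
  have hr1 : r < 1 := by nlinarith [Real.exp_pos (-θ * T)]
  have hφb : ∀ s ∈ Icc 0 T, 0 ≤ φ s ∧ φ s ≤ r := by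
    intro s hs
    have h1 : Real.exp (-θ * (T - s)) ≤ 1 := Real.exp_le_one_iff.2 (by nlinarith [hs.2])
    have h2 : Real.exp (-θ * T) ≤ Real.exp (-θ * (T - s)) :=
      Real.exp_le_exp.2 (by nlinarith [hs.1])
    exact ⟨by simp only [hφ]; nlinarith [Real.exp_pos (-θ * (T - s))],
      by simp only [hφ, hr]; nlinarith⟩
  have hr0 : 0 ≤ r := (hφb 0 ⟨le_rfl, hT⟩).1.trans (hφb 0 ⟨le_rfl, hT⟩).2
  have hrn : ‖r‖ < 1 := by rwa [Real.norm_of_nonneg hr0]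
  have dφ : HasACDerivOn φ (fun s => θ * (φ s - 1)) T := .of_contDiff (by fun_prop) fun s => by
    have := (((((hasDerivAt_id s).const_sub T).const_mul (-θ)).exp).const_mul (z - 1)).const_add 1
    exact this.congr_deriv (by simp only [hφ, id]; ring)
  have dφn : ∀ n : ℕ, HasACDerivOn (fun s => φ s ^ n)
      (fun s => n * φ s ^ (n - 1) * (θ * (φ s - 1))) T := fun n => by
    refine ⟨ContDiffOn.absolutelyContinuousOnInterval (by fun_prop), ?_⟩
    filter_upwards [dφ.2] with s hs hsT using (hs hsT).pow n
  have hA : IntervalIntegrable (fun s => lam s * (φ s - 1)) volume 0 T :=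
    hlam.mul_continuousOn (by fun_prop)
  set A : ℝ → ℝ := fun t => ∫ s in (0 : ℝ)..t, lam s * (φ s - 1) with hAdef
  have dA : HasACDerivOn A (fun s => lam s * (φ s - 1)) T :=
    .of_integral hT hA fun s _ => by simp [hAdef]
  have de : HasACDerivOn (fun s => Real.exp (-1 * A s))
      (fun s => Real.exp (-1 * A s) * (-1 * (lam s * (φ s - 1)))) T := (dA.const_mul (-1)).exp
  have cp : ∀ n : ℕ, ContinuousOn (fun s => (P s).real {n}) (uIcc 0 T) := fun n =>
    (h.cont n).mono (by rw [uIcc_of_le hT]; exact Icc_subset_Ici_self)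
  have dp : ∀ n : ℕ, HasACDerivOn (fun s => (P s).real {n}) (fun s =>
      lam s * ((if n = 0 then 0 else (P s).real {n - 1}) - (P s).real {n})
        + θ * (((n : ℝ) + 1) * (P s).real {n + 1} - (n : ℝ) * (P s).real {n})) T := fun n => by
    refine .of_integral hT ?_ fun t ht => h.forward t ht.1 n
    have c1 : ContinuousOn (fun s => if n = 0 then 0 else (P s).real {n - 1}) (uIcc 0 T) := by
      by_cases hn : n = 0
      · simpa [hn] using continuousOn_const
      · simpa [hn] using cp (n - 1)
    have c2 := cp n
    have c3 := cp (n + 1)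
    exact (hlam.mul_continuousOn (c1.sub c2)).add
      (ContinuousOn.intervalIntegrable (by fun_prop))
  have dF := fun n : ℕ => ((dp n).mul (dφn n)).mul de
  obtain ⟨C, hC⟩ := de.1.exists_bound
  have hC0 : 0 ≤ C := (norm_nonneg _).trans (hC 0 left_mem_uIcc)
  have b0 := (summable_geometric_of_lt_one hr0 hr1).hasSum
  have b1 := (summable_pow_mul_geometric_of_norm_lt_one 1 hrn).hasSum
  have b2 : Summable fun n : ℕ => (n : ℝ) * r ^ (n - 1) := by
    rw [← summable_nat_add_iff 1]
    refine ((summable_pow_mul_geometric_of_norm_lt_one 1 hrn).add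
      (summable_geometric_of_lt_one hr0 hr1)).congr fun n => ?_
    simp; ring
  -- This sums the bounds on the derivatives of `p_n φ^n e^{-A}`, whose sum over `n` is zero;
  -- summing their integrals equates the values at `0` and `T`.
  have hb := fun s => ((((b0.mul_left (2 * |lam s| + θ)).add (b1.mul_left (2 * θ))).add
    (b2.hasSum.mul_left θ))).mul_left C
  have hsum := intervalIntegral.hasSum_integral_of_dominated_convergence (μ := volume)
    (a := 0) (b := T) (f := fun _ => (0 : ℝ)) (F := fun (n : ℕ) s => _)
    (fun (n : ℕ) s => C * ((2 * |lam s| + θ) * r ^ n + 2 * θ * ((n : ℝ) ^ 1 * r ^ n) +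
      θ * (n * r ^ (n - 1))))
    (fun n => (dF n).intervalIntegrable.def'.aestronglyMeasurable)
    (fun n => .of_forall fun s hs => ?_) (.of_forall fun s _ => (hb s).summable)
    (by
      simp_rw [fun s => (hb s).tsum_eq]
      have := hlam.abs
      refine ((((this.const_mul 2).add ?_).mul_const _).add ?_ |>.add ?_).const_mul C
      all_goals exact intervalIntegrable_const)
    (.of_forall fun s hs => ?_)
  · simp_rw [fun n => (dF n).integral_eq] at hsum
    have hinit : HasSum (fun n : ℕ => (P 0).real {n} * φ 0 ^ n * Real.exp (-1 * A 0)) (r ^ n₀) := by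
      have : (fun n : ℕ => (P 0).real {n} * φ 0 ^ n * Real.exp (-1 * A 0)) =
          fun n => if n = n₀ then r ^ n₀ else 0 := by
        funext n
        rw [h.init]
        by_cases hn : n = n₀
        · subst hn; simp [hAdef, hφ, hr, measureReal_def]
        · simp [measureReal_def, hn, Ne.symm hn]
      rw [this]
      exact hasSum_ite_eq n₀ _
    have hfin := (hsum.add hinit).mul_right (Real.exp (A T))
    have hAT : A T = (z - 1) * mmInfMean lam θ T := by
      simp only [hAdef, mmInfMean]
      rw [← intervalIntegral.integral_const_mul, ← intervalIntegral.integral_const_mul]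
      refine intervalIntegral.integral_congr fun s _ => ?_
      have : Real.exp (-θ * (T - s)) = Real.exp (-θ * T) * Real.exp (θ * s) := by
        rw [← Real.exp_add]; ring_nf
      simp only [hφ, this]; ring
    simp only [intervalIntegral.integral_zero, zero_add, sub_add_cancel] at hfin
    rw [hAT] at hfin
    have he : Real.exp (-1 * ((z - 1) * mmInfMean lam θ T)) *
        Real.exp ((z - 1) * mmInfMean lam θ T) = 1 := by rw [← Real.exp_add]; simp
    have hφT : φ T = z := by simp [hφ]
    simp_rw [hφT, mul_assoc _ (Real.exp _), he, mul_one] at hfin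
    exact hfin
  · rw [uIoc_of_le hT] at hs
    have hs' : s ∈ Icc 0 T := ⟨hs.1.le, hs.2⟩
    obtain ⟨hf0, hf1⟩ := hφb s hs'
    have hpos : ∀ n, 0 ≤ (P s).real {n} := fun n => measureReal_nonneg
    have hle : ∀ n, (P s).real {n} ≤ 1 := fun n => (abs_le.1 (h.abs_real_le_one hs'.1 n)).2
    have hprev : |(if n = 0 then 0 else (P s).real {n - 1}) - (P s).real {n}| ≤ 1 := by
      have := hpos n; have := hle n; have := hpos (n - 1); have := hle (n - 1)
      split_ifs <;> exact abs_le.2 ⟨by linarith, by linarith⟩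
    have hdeath : |((n : ℝ) + 1) * (P s).real {n + 1} - (n : ℝ) * (P s).real {n}| ≤ 2 * n + 1 := by
      have hn : (0 : ℝ) ≤ n := n.cast_nonneg
      have := mul_nonneg (by linarith : (0 : ℝ) ≤ n + 1) (hpos (n + 1))
      have := mul_le_of_le_one_right (by linarith : (0 : ℝ) ≤ n + 1) (hle (n + 1))
      have := mul_nonneg hn (hpos n)
      have := mul_le_of_le_one_right hn (hle n)
      exact abs_le.2 ⟨by linarith, by linarith⟩
    have hφn : ∀ k : ℕ, |φ s ^ k| ≤ r ^ k := fun k => by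
      rw [abs_of_nonneg (pow_nonneg hf0 k)]; exact pow_le_pow_left₀ hf0 hf1 k
    have hφ1 : |φ s - 1| ≤ 1 := abs_le.2 ⟨by linarith, by linarith⟩
    have hp1 := h.abs_real_le_one hs'.1 n
    have he := hC s (by rwa [uIcc_of_le hT])
    set p' := lam s * ((if n = 0 then 0 else (P s).real {n - 1}) - (P s).real {n})
        + θ * (((n : ℝ) + 1) * (P s).real {n + 1} - (n : ℝ) * (P s).real {n}) with hp'
    have hp'b : |p'| ≤ |lam s| + θ * (2 * n + 1) := by
      refine (abs_add_le _ _).trans (add_le_add ?_ ?_)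
      · rw [abs_mul]; exact mul_le_of_le_one_right (abs_nonneg _) hprev
      · rw [abs_mul, abs_of_pos hθ]; gcongr
    have t1 : |p' * φ s ^ n| ≤ (|lam s| + θ * (2 * n + 1)) * r ^ n := by
      rw [abs_mul]; exact mul_le_mul hp'b (hφn n) (abs_nonneg _) (by positivity)
    have t2 : |(P s).real {n} * (n * φ s ^ (n - 1) * (θ * (φ s - 1)))| ≤
        θ * (n * r ^ (n - 1)) := by
      rw [abs_mul, abs_mul, abs_mul, abs_mul, abs_of_pos hθ, Nat.abs_cast]
      calc _ ≤ 1 * (n * r ^ (n - 1) * (θ * 1)) := by gcongr; exact hφn _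
        _ = _ := by ring
    have t3 : |(P s).real {n} * φ s ^ n * (-1 * (lam s * (φ s - 1)))| ≤ |lam s| * r ^ n := by
      rw [abs_mul, abs_mul, abs_mul, abs_mul, abs_neg, abs_one]
      calc _ ≤ 1 * r ^ n * (1 * (|lam s| * 1)) := by gcongr; exact hφn _
        _ = _ := by ring
    have heq : (p' * φ s ^ n + (P s).real {n} * (n * φ s ^ (n - 1) * (θ * (φ s - 1)))) *
          Real.exp (-1 * A s) + (P s).real {n} * φ s ^ n *
          (Real.exp (-1 * A s) * (-1 * (lam s * (φ s - 1)))) =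
        Real.exp (-1 * A s) * (p' * φ s ^ n +
          (P s).real {n} * (n * φ s ^ (n - 1) * (θ * (φ s - 1))) +
          (P s).real {n} * φ s ^ n * (-1 * (lam s * (φ s - 1)))) := by ring
    change ‖(p' * φ s ^ n + (P s).real {n} * (n * φ s ^ (n - 1) * (θ * (φ s - 1)))) *
          Real.exp (-1 * A s) + (P s).real {n} * φ s ^ n *
          (Real.exp (-1 * A s) * (-1 * (lam s * (φ s - 1))))‖ ≤ _
    rw [heq, norm_mul]
    refine mul_le_mul he ?_ (norm_nonneg _) hC0
    refine (abs_add_le _ _).trans ((add_le_add ((abs_add_le _ _).trans (add_le_add t1 t2))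
      t3).trans (le_of_eq ?_))
    ring
  · rw [uIoc_of_le hT] at hs
    have hs' : s ∈ Icc 0 T := ⟨hs.1.le, hs.2⟩
    obtain ⟨hf0, hf1⟩ := hφb s hs'
    have := hasSum_forward_transport (ℓ := lam s) (θ := θ) (e := Real.exp (-1 * A s))
      (h.abs_real_le_one hs'.1) hf0 (hf1.trans_lt hr1)
    simpa only [neg_one_mul] using this

theorem hasSum_pow (h : IsMMInfLaw lam θ n₀ P) (hθ : 0 < θ) (hT : 0 ≤ T)
    (hlam : IntervalIntegrable lam volume 0 T) (z : ℝ) :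
    HasSum (fun n => (P T).real {n} * z ^ n)
      ((1 + (z - 1) * Real.exp (-θ * T)) ^ n₀ * Real.exp ((z - 1) * mmInfMean lam θ T)) :=
  hasSum_of_hasSum_of_differentiable
    (g := fun z => (1 + (z - 1) * Real.exp (-θ * T)) ^ n₀ *
      Real.exp ((z - 1) * mmInfMean lam θ T))
    (G := fun z => (1 + (z - 1) * (Real.exp (-θ * T) : ℂ)) ^ n₀ *
      Complex.exp ((z - 1) * (mmInfMean lam θ T : ℂ)))
    (by fun_prop) (fun x => by push_cast; rfl) (h.abs_real_le_one hT)
    (fun _ hz0 hz1 => h.hasSum_pow_of_lt_one hθ hT hlam hz0 hz1) z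

theorem integrable_exp_and_mgf_eq (h : IsMMInfLaw lam θ n₀ P) (hθ : 0 < θ) (hT : 0 ≤ T)
    (hlam : IntervalIntegrable lam volume 0 T) (α : ℝ) :
    Integrable (fun k : ℕ => Real.exp (α * (k : ℝ))) (P T) ∧
      mgf (fun k : ℕ => (k : ℝ)) (P T) α = mmInfMGF lam θ n₀ T α := by
  have := h.prob T hT
  have hs := h.hasSum_pow hθ hT hlam (Real.exp α)
  have hpow : ∀ k : ℕ, Real.exp α ^ k = Real.exp (α * k) := fun k => by
    rw [← Real.exp_nat_mul, mul_comm]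
  simp_rw [hpow] at hs
  have hint : Integrable (fun k : ℕ => Real.exp (α * (k : ℝ))) (P T) := by
    rw [← Measure.sum_smul_dirac (P T)]
    refine integrable_sum_dirac (fun k => measure_ne_top _ _) ?_
    simpa [measureReal_def] using hs.summable
  refine ⟨hint, ?_⟩
  rw [mgf, integral_countable hint]
  simp only [smul_eq_mul]
  rw [hs.tsum_eq, mmInfMGF, Real.exp_add, mul_comm, Real.exp_nat_mul,
    Real.exp_log (survivalMGF_pos hθ hT), survivalMGF]

end IsMMInfLaw

/-! ### Analytic continuation in `α` and identification of laws. -/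

theorem analyticOnNhd_mgf_id {ν : Measure ℝ} (h : ∀ α, Integrable (fun x : ℝ => Real.exp (α * x)) ν) :
    AnalyticOnNhd ℝ (mgf id ν) univ := by
  have : integrableExpSet id ν = univ := eq_univ_of_forall h
  have h2 := analyticOnNhd_mgf (X := id) (μ := ν)
  rwa [this, interior_univ] at h2

theorem Measure.eq_of_mgf_id_eq {ν₁ ν₂ : Measure ℝ} [IsProbabilityMeasure ν₁]
    [IsProbabilityMeasure ν₂] (h : ∀ α, Integrable (fun x : ℝ => Real.exp (α * x)) ν₁)
    (heq : mgf id ν₁ = mgf id ν₂) : ν₁ = ν₂ := by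
  have hu : integrableExpSet id ν₁ = univ := eq_univ_of_forall h
  refine Measure.ext_of_complexMGF_id_eq (funext fun z => ?_)
  exact eqOn_complexMGF_of_mgf heq (by simp [hu])

/-- `I` may lie on one side of `0`; accumulation there is all that the identity theorem needs. -/
theorem Set.OrdConnected.exists_frequently_mem {I : Set ℝ} (hI : I.OrdConnected)
    (hn : I.Nontrivial) (h0 : 0 ∈ I) : ∃ᶠ x in nhdsWithin (0 : ℝ) {0}ᶜ, x ∈ I := by
  obtain ⟨b, hb, hb0⟩ := hn.exists_ne 0
  rcases lt_or_gt_of_ne hb0 with h | h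
  · have : ∀ᶠ x in nhdsWithin (0 : ℝ) (Iio 0), x ∈ I := by
      filter_upwards [Ioo_mem_nhdsLT h] with x hx using hI.out hb h0 ⟨hx.1.le, hx.2.le⟩
    exact this.frequently.filter_mono (nhdsWithin_mono _ fun x hx => ne_of_lt hx)
  · have : ∀ᶠ x in nhdsWithin (0 : ℝ) (Ioi 0), x ∈ I := by
      filter_upwards [Ioo_mem_nhdsGT h] with x hx using hI.out h0 hb ⟨hx.1.le, hx.2.le⟩
    exact this.frequently.filter_mono (nhdsWithin_mono _ fun x hx => ne_of_gt hx)

theorem mgf_id_map_natCast_add {P : Measure ℕ} (γ α : ℝ) :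
    mgf id (P.map fun k : ℕ => (k : ℝ) + γ) α =
      Real.exp (α * γ) * mgf (fun k : ℕ => (k : ℝ)) P α := by
  rw [mgf_id_map (by fun_prop), mgf_add_const, mul_comm]

theorem mainTheorem10
    (lam : ℝ → ℝ) (c : ℕ) (μ θ q₀ γ : ℝ)
    (hc : 0 < c) (hμ : 0 < μ) (hθ : 0 < θ)
    (hlam_int : ∀ T, 0 ≤ T → IntervalIntegrable lam volume 0 T)
    (hlam : ∃ l : ℝ, (c : ℝ) * μ < l ∧ ∀ t, 0 ≤ t → l ≤ lam t)
    (hq : (c : ℝ) < q₀)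
    (hγ : γ = (c : ℝ) * (θ - μ) / θ) :
    ∃ N : ℝ → ℝ → ℝ,
      -- `N` is the MGF of the `M/M/∞` queue with initial value `q₀ - γ`
      IsMMInfMGF lam θ (q₀ - γ) N ∧
      (∀ N', IsMMInfMGF lam θ (q₀ - γ) N' → ∀ t, 0 ≤ t → ∀ α, N' t α = N t α) ∧
      (∀ n₀ : ℕ, (n₀ : ℝ) = q₀ - γ → ∀ P, IsMMInfLaw lam θ n₀ P →
        ∀ t, 0 ≤ t → ∀ α,
          Integrable (fun k : ℕ => Real.exp (α * (k : ℝ))) (P t) ∧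
          mgf (fun k : ℕ => (k : ℝ)) (P t) α = N t α) ∧
      -- the fluid MGF exists, is unique, and equals the MGF of that queue shifted by `γ`
      (∃ δ : ℝ, 0 < δ ∧
        IsFluidMGF lam c μ θ q₀ (Ioi (-δ)) (fun t α => Real.exp (α * γ) * N t α) ∧
        ∀ (I : Set ℝ) (M : ℝ → ℝ → ℝ), I.OrdConnected → (0 : ℝ) ∈ I →
          IsFluidMGF lam c μ θ q₀ I M →
          ∀ t, 0 ≤ t → ∀ α ∈ I, -δ < α → M t α = Real.exp (α * γ) * N t α) ∧
      -- if the fluid MGF is the MGF of random variables with laws `ν t`: equality for all real `α`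
      (∀ (I : Set ℝ) (ν : ℝ → Measure ℝ), I.OrdConnected → I.Nontrivial → (0 : ℝ) ∈ I →
        (∀ t, 0 ≤ t → IsProbabilityMeasure (ν t) ∧
          ∀ α, Integrable (fun x : ℝ => Real.exp (α * x)) (ν t)) →
        IsFluidMGF lam c μ θ q₀ I (fun t α => mgf id (ν t) α) →
        (∀ t, 0 ≤ t → ∀ α, mgf id (ν t) α = Real.exp (α * γ) * N t α) ∧
        (∀ n₀ : ℕ, (n₀ : ℝ) = q₀ - γ → ∀ P, IsMMInfLaw lam θ n₀ P →
          ∀ t, 0 ≤ t → ν t = (P t).map (fun k : ℕ => (k : ℝ) + γ))) := by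
  obtain ⟨l, hcl, hl⟩ := hlam
  -- In this form the threshold is visibly positive and below `l / θ`.
  have hκ : (c : ℝ) - γ = c * μ / θ := by rw [hγ]; field_simp; ring
  have hcpos : (0 : ℝ) < c := Nat.cast_pos.2 hc
  obtain ⟨δ, hδ, hR⟩ := exists_le_mmInfLogDeriv (x₀ := q₀ - γ) (κ := c - γ) hθ
    (by rw [hκ]; positivity) (by rw [hκ]; gcongr) (by linarith) hlam_int hl
  have hN := isMMInfMGF_mmInfMGF (x₀ := q₀ - γ) hθ hlam_int
  have hlaw : ∀ n₀ : ℕ, (n₀ : ℝ) = q₀ - γ → ∀ P, IsMMInfLaw lam θ n₀ P → ∀ t, 0 ≤ t → ∀ α,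
      Integrable (fun k : ℕ => Real.exp (α * (k : ℝ))) (P t) ∧
        mgf (fun k : ℕ => (k : ℝ)) (P t) α = mmInfMGF lam θ (q₀ - γ) t α :=
    fun n₀ hn P hP t ht α => hn ▸ hP.integrable_exp_and_mgf_eq hθ ht (hlam_int t ht) α
  have hfluid : IsFluidMGF lam c μ θ q₀ (Ioi (-δ))
      (fun t α => Real.exp (α * γ) * mmInfMGF lam θ (q₀ - γ) t α) :=
    isFluidMGF_exp_mul_mmInfMGF hθ hγ hlam_int fun t ht α hα => hR t ht α hα
  have huniq : ∀ (I : Set ℝ) (M : ℝ → ℝ → ℝ), I.OrdConnected → (0 : ℝ) ∈ I →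
      IsFluidMGF lam c μ θ q₀ I M → ∀ t, 0 ≤ t → ∀ α ∈ I, -δ < α →
      M t α = Real.exp (α * γ) * mmInfMGF lam θ (q₀ - γ) t α :=
    fun I M hI hI0 hM t ht α hαI hα => hM.eq_of_ordConnected hμ.le hθ.le hlam_int hfluid hI
      ordConnected_Ioi hI0 (neg_lt_zero.2 hδ) ht hαI hα
  refine ⟨mmInfMGF lam θ (q₀ - γ), hN,
    fun N' hN' t ht α => hN'.unique hθ.le hlam_int hN ht α, hlaw, ⟨δ, hδ, hfluid, huniq⟩, ?_⟩
  intro I ν hI hIn hI0 hν hM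
  have hall : ∀ t, 0 ≤ t → ∀ α,
      mgf id (ν t) α = Real.exp (α * γ) * mmInfMGF lam θ (q₀ - γ) t α := by
    intro t ht α
    have h1 := analyticOnNhd_mgf_id (hν t ht).2
    have h2 : AnalyticOnNhd ℝ (fun α => Real.exp (α * γ) * mmInfMGF lam θ (q₀ - γ) t α) univ :=
      fun α hα => AnalyticAt.mul (by fun_prop) (analyticOnNhd_mmInfMGF hθ ht α hα)
    refine congrFun (h1.eq_of_frequently_eq h2 (z₀ := 0) ?_) α
    have hev : ∀ᶠ x in nhdsWithin (0 : ℝ) {0}ᶜ, -δ < x :=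
      nhdsWithin_le_nhds (Ioi_mem_nhds (neg_lt_zero.2 hδ))
    exact ((hI.exists_frequently_mem hIn hI0).and_eventually hev).mono fun x hx =>
      huniq I _ hI hI0 hM t ht x hx.1 hx.2
  refine ⟨hall, fun n₀ hn P hP t ht => ?_⟩
  have := (hν t ht).1
  have := hP.prob t ht
  have : IsProbabilityMeasure ((P t).map fun k : ℕ => (k : ℝ) + γ) :=
    Measure.isProbabilityMeasure_map (by fun_prop)
  refine Measure.eq_of_mgf_id_eq (hν t ht).2 (funext fun α => ?_)
  rw [hall t ht α, mgf_id_map_natCast_add, (hlaw n₀ hn P hP t ht α).2]
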